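/- Let $\mathbb F$ be a nonabelian free group of finite rank. For an integer $g\ge 0$ let $H_g=\langle a_1,b_1,\dots,a_g,b_g\rangle$ be the free group of rank $2g$ on the indicated generators, and let $\partial_g=[a_1,b_1]\cdots[a_g,b_g]\in H_g$, where $[a,b]=aba^{-1}b^{-1}$. For $x\in\mathbb F$, a genus $g$ representation of $x$ is a homomorphism $h\colon H_g\to\mathbb F$ with $h(\partial_g)=x$. It is called admissible if $h$ is injective and its image is root-closed in $\mathbb F$, i.e. whenever $t\in\mathbb F$ and $t^n\in h(H_g)$ for some integer $n\ge 1$, then $t\in h(H_g)$. Define $$f'_{\mathbb F}(g)=\sup_{x\in\mathbb F}\bigl|\{\,h(H_g) : h \text{ is an admissible genus } g \text{ representation of } x\,\}\bigr|\in\{0,1,2,\dots\}\cup\{\infty\}.$$ Then $f'_{\mathbb F}(1)\ge 2$, and $f'_{\mathbb F}(m+n)\ge f'_{\mathbb F}(m)\,f'_{\mathbb F}(n)$ for all integers $m,n\ge 0$. -/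

import Mathlib

open scoped commutatorElement

/-- The free group `H_g = ⟨a₁, b₁, …, a_g, b_g⟩` of rank `2g`, the fundamental group of a compact
orientable surface of genus `g` with one boundary component. The basis element `a_i` is
`FreeGroup.of (Sum.inl i)`, and `b_i` is `FreeGroup.of (Sum.inr i)`. -/
abbrev SurfaceGroup (g : ℕ) : Type := FreeGroup (Fin g ⊕ Fin g)

/-- The boundary element `∂_g = [a₁, b₁] ⋯ [a_g, b_g]` of `H_g` (in this order), where
`[a, b] = a * b * a⁻¹ * b⁻¹`. -/
def surfaceBoundary (g : ℕ) : SurfaceGroup g :=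
  (List.ofFn fun i : Fin g =>
    ⁅(FreeGroup.of (Sum.inl i) : SurfaceGroup g), FreeGroup.of (Sum.inr i)⁆).prod

/-- `h` is a genus `g` representation of `x`: a homomorphism `H_g → F` taking `∂_g` to `x`. -/
def IsGenusRep {F : Type*} [Group F] {g : ℕ} (h : SurfaceGroup g →* F) (x : F) : Prop :=
  h (surfaceBoundary g) = x

/-- An admissible genus `g` representation of `x`: injective with root-closed (primitive) image.
`PowSaturated` says that `t ^ n ∈ h.range` implies `n = 0` or `t ∈ h.range`. -/
structure IsAdmissibleRep {F : Type*} [Group F] {g : ℕ} (h : SurfaceGroup g →* F) (x : F) :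
    Prop where
  isGenusRep : IsGenusRep h x
  injective : Function.Injective h
  rootClosed : h.range.PowSaturated

/-- The set of images of the admissible genus `g` representations of `x`. -/
def admissibleImages {F : Type*} [Group F] (g : ℕ) (x : F) : Set (Subgroup F) :=
  {A | ∃ h : SurfaceGroup g →* F, IsAdmissibleRep h x ∧ h.range = A}

/-- The number of distinct images of admissible genus `g` representations of `x`. -/
noncomputable def numImages {F : Type*} [Group F] (g : ℕ) (x : F) : ℕ∞ :=
  (admissibleImages g x).encard

/-- `f'_F(g)`: the supremum over `x : F` of the number of distinct images of admissible
genus `g` representations of `x`. -/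
noncomputable def fPrime (F : Type*) [Group F] (g : ℕ) : ℕ∞ :=
  ⨆ x : F, numImages g x

/-! Root-closed embeddings compose, so `fPrime` can only grow along one
(`fPrime_le_of_isRootClosedEmbedding`). For superadditivity, let `A` and `B` be admissible images
for `x` and `y`. Since `∂_{m+n}` is a product of copies of `∂_m` and `∂_n`, the free product `A * B`
inside `F * F` is the image of a genus `m + n` representation of the product of `x` and `y`, taken
in the two factors. It is root-closed by a normal form argument (`isRootClosedEmbedding_lift`), and
it determines `A` and `B` as its intersections with the factors. Finally `F * F` is free of
countable rank, hence embeds root-closed in `F`. For genus 1, one element of the free group on two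
letters is written as a commutator in two ways, with distinct root-closed images; this is then
transported to `F`. -/

/-! ### Root-closed embeddings. -/

/-- An injective homomorphism with root-closed image. -/
structure IsRootClosedEmbedding {A G : Type*} [Group A] [Group G] (f : A →* G) : Prop where
  injective : Function.Injective f
  rootClosed : f.range.PowSaturated

namespace IsRootClosedEmbedding

theorem comp {A B G : Type*} [Group A] [Group B] [Group G] {f : B →* G} {g : A →* B}
    (hf : IsRootClosedEmbedding f) (hg : IsRootClosedEmbedding g) :
    IsRootClosedEmbedding (f.comp g) where
  injective := hf.injective.comp hg.injective
  rootClosed := by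
    rintro n t ⟨a, ha⟩
    rcases hf.rootClosed (n := n) (g := t) ⟨g a, ha⟩ with h | ⟨s, rfl⟩
    · exact Or.inl h
    · have hs : s ^ n ∈ g.range := ⟨a, hf.injective (by simpa using ha)⟩
      rcases hg.rootClosed hs with h | ⟨c, rfl⟩
      · exact Or.inl h
      · exact Or.inr ⟨c, rfl⟩

theorem of_mulEquiv {A G : Type*} [Group A] [Group G] (e : A ≃* G) :
    IsRootClosedEmbedding e.toMonoidHom where
  injective := e.injective
  rootClosed := fun _ t _ => Or.inr ⟨e.symm t, by simp⟩

/-- A subgroup which is a retract of the kernel of a homomorphism to a torsion-free group is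
root-closed; the retraction is presented by means of a map to a semidirect product. -/
theorem of_semidirectProduct {A G N Q : Type*} [Group A] [Group G] [Group N] [Group Q]
    [IsMulTorsionFree G] [IsMulTorsionFree Q] {θ : Q →* MulAut N} (f : A →* G)
    (ρ : G →* N ⋊[θ] Q) (k : A →* N) (q : N →* A)
    (hk : ρ.comp f = SemidirectProduct.inl.comp k) (hq : q.comp k = MonoidHom.id A) :
    IsRootClosedEmbedding f where
  injective := by
    refine Function.LeftInverse.injective (g := fun x => q (ρ x).left) fun a => ?_
    have h1 := DFunLike.congr_fun hk a
    have h2 := DFunLike.congr_fun hq a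
    simp only [MonoidHom.comp_apply] at h1 h2
    simpa [h1] using h2
  rootClosed := by
    rintro n t ⟨a, ha⟩
    refine or_iff_not_imp_left.2 fun hn => ?_
    have h1 : ρ t ^ n = SemidirectProduct.inl (k a) := by
      rw [← map_pow, ← ha]
      exact DFunLike.congr_fun hk a
    have h2 : (ρ t).right = 1 := by
      have h3 := congrArg SemidirectProduct.rightHom h1
      rw [map_pow, SemidirectProduct.rightHom_inl] at h3
      exact (pow_eq_one_iff_left hn).1 h3
    have h4 : ρ t = SemidirectProduct.inl (ρ t).left := by
      ext <;> simp [h2]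
    rw [h4, ← map_pow] at h1
    have h5 := congrArg q (SemidirectProduct.inl_injective h1)
    have h6 : q (k a) = a := DFunLike.congr_fun hq a
    rw [h6, map_pow] at h5
    -- `f (q (ρ t).left)` and `t` have the same `n`-th power, and roots in `G` are unique.
    exact ⟨q (ρ t).left, pow_left_injective hn (by simp only [← map_pow, h5, ha])⟩

end IsRootClosedEmbedding

/-! ### Countable-rank free groups inside nonabelian free groups. -/

/-- The action of `ℤ` on the free group on `ℤ` by translation of the generators. -/
def freeGroupShift : Multiplicative ℤ →* MulAut (FreeGroup ℤ) where
  toFun n := FreeGroup.freeGroupCongr (Equiv.addLeft n.toAdd)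
  map_one' := by
    ext x
    change FreeGroup.map _ x = x
    simp
  map_mul' m n := by
    refine MulEquiv.toMonoidHom_injective (FreeGroup.ext_hom _ _ fun i => ?_)
    simp [add_assoc]

@[simp]
theorem freeGroupShift_of (n : Multiplicative ℤ) (i : ℤ) :
    freeGroupShift n (FreeGroup.of i) = FreeGroup.of (n.toAdd + i) := by
  simp [freeGroupShift]

theorem inr_mul_inl_mul_inr_inv_freeGroupShift (n : Multiplicative ℤ) (i : ℤ) :
    (SemidirectProduct.inr n * SemidirectProduct.inl (FreeGroup.of i) *
      SemidirectProduct.inr n⁻¹ : FreeGroup ℤ ⋊[freeGroupShift] Multiplicative ℤ) =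
      SemidirectProduct.inl (FreeGroup.of (n.toAdd + i)) := by
  rw [← freeGroupShift_of, SemidirectProduct.inl_aut]

/-- A nonabelian free group contains root-closed copies of all free groups of countable rank. -/
theorem exists_isRootClosedEmbedding_freeGroup {X : Type*} [Nontrivial X] (Y : Type*)
    [Countable Y] : ∃ f : FreeGroup Y →* FreeGroup X, IsRootClosedEmbedding f := by
  classical
  obtain ⟨x, y, hxy⟩ := exists_pair_ne X
  obtain ⟨e, he⟩ := exists_injective_nat Y
  let E : Y → ℤ := fun i => e i
  have hE : Function.Injective E := fun i j h => he (by simpa [E] using h)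
  let f : FreeGroup Y →* FreeGroup X := FreeGroup.lift fun i =>
    FreeGroup.of x ^ E i * FreeGroup.of y * (FreeGroup.of x ^ E i)⁻¹
  -- `x` becomes the shift and all other generators collapse to the generator at `0`, so the
  -- conjugate of `y` by `x ^ E i` goes to the generator at `E i`.
  let ρ : FreeGroup X →* FreeGroup ℤ ⋊[freeGroupShift] Multiplicative ℤ :=
    FreeGroup.lift fun z => if z = x then SemidirectProduct.inr (Multiplicative.ofAdd 1) else
      SemidirectProduct.inl (FreeGroup.of 0)
  refine ⟨f, .of_semidirectProduct f ρ (FreeGroup.map E)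
    (FreeGroup.lift (Function.extend E FreeGroup.of 1)) ?_ ?_⟩
  · ext1 i
    have h := inr_mul_inl_mul_inr_inv_freeGroupShift (Multiplicative.ofAdd (E i)) 0
    simp only [toAdd_ofAdd, add_zero] at h
    simp only [MonoidHom.comp_apply, f, ρ, FreeGroup.lift_apply_of, map_mul, map_inv, map_zpow,
      if_true, if_neg hxy.symm, FreeGroup.map.of, ← h]
    have hz : (Multiplicative.ofAdd 1 : Multiplicative ℤ) ^ E i = Multiplicative.ofAdd (E i) := by
      rw [← ofAdd_zsmul, smul_eq_mul, mul_one]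
    rw [← map_zpow, hz]
  · ext1 i
    simp [hE.extend_apply]

theorem nontrivial_of_freeGroupBasis {X F : Type*} [Group F] (B : FreeGroupBasis X F)
    (hF : ∃ a b : F, a * b ≠ b * a) : Nontrivial X := by
  by_contra h
  rw [not_nontrivial_iff_subsingleton] at h
  obtain ⟨a, b, hab⟩ := hF
  refine hab (B.repr.injective ?_)
  rw [map_mul, map_mul]
  rcases isEmpty_or_nonempty X with hX | ⟨⟨x⟩⟩
  · exact Subsingleton.elim _ _
  · have : Unique X := ⟨⟨x⟩, fun y => Subsingleton.elim _ _⟩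
    have h := FreeGroup.mulEquivIntOfUnique (α := X)
    exact h.injective (by rw [map_mul, map_mul, mul_comm])

theorem countable_of_group_fg (F : Type*) [Group F] [Group.FG F] : Countable F := by
  obtain ⟨S, hS, f, hf⟩ := Group.fg_iff_exists_freeGroup_hom_surjective_finite.1 ‹Group.FG F›
  have := hS
  exact hf.countable

/-! ### Normal forms, powers and root-closed subgroups in free products. -/

namespace Monoid.CoprodI

variable {ι : Type*} {G : ι → Type*} [∀ i, Group (G i)]

/-- A list of syllables is reduced if no syllable is trivial and neighbours lie in different
factors. -/
structure IsReducedList (l : List (Σ i, G i)) : Prop where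
  ne_one : ∀ x ∈ l, x.2 ≠ 1
  isChain : (l.map Sigma.fst).IsChain (· ≠ ·)

/-- The product of a list of syllables. -/
def listProd (l : List (Σ i, G i)) : CoprodI G := (l.map fun x => of x.2).prod

@[simp]
theorem listProd_nil : listProd ([] : List (Σ i, G i)) = 1 := rfl

@[simp]
theorem listProd_cons (x : Σ i, G i) (l : List (Σ i, G i)) :
    listProd (x :: l) = of x.2 * listProd l := by simp [listProd]

@[simp]
theorem listProd_append (l l' : List (Σ i, G i)) :
    listProd (l ++ l') = listProd l * listProd l' := by simp [listProd]

theorem exists_isReducedList (t : CoprodI G) :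
    ∃ l : List (Σ i, G i), IsReducedList l ∧ listProd l = t := by
  classical
  refine ⟨(Word.equiv t).toList, ⟨(Word.equiv t).ne_one, ?_⟩, Word.equiv.symm_apply_apply t⟩
  exact (List.isChain_map _).2 (Word.equiv t).chain_ne

theorem IsReducedList.eq_of_listProd_eq {l l' : List (Σ i, G i)} (hl : IsReducedList l)
    (hl' : IsReducedList l') (h : listProd l = listProd l') : l = l' := by
  classical
  let w : Word G := ⟨l, hl.ne_one, (List.isChain_map _).1 hl.isChain⟩
  let w' : Word G := ⟨l', hl'.ne_one, (List.isChain_map _).1 hl'.isChain⟩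
  have hw : w = w' := Word.equiv.symm.injective h
  exact congrArg Word.toList hw

theorem IsReducedList.append {l l' : List (Σ i, G i)} (hl : IsReducedList l)
    (hl' : IsReducedList l') (h : ∀ i ∈ (l.map Sigma.fst).getLast?,
      ∀ j ∈ (l'.map Sigma.fst).head?, i ≠ j) : IsReducedList (l ++ l') where
  ne_one x hx := (List.mem_append.1 hx).elim (hl.ne_one x) (hl'.ne_one x)
  isChain := by
    rw [List.map_append, List.isChain_append]
    exact ⟨hl.isChain, hl'.isChain, h⟩

theorem isReducedList_append_iff {l l' : List (Σ i, G i)} :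
    IsReducedList (l ++ l') ↔ IsReducedList l ∧ IsReducedList l' ∧
      ∀ i ∈ (l.map Sigma.fst).getLast?, ∀ j ∈ (l'.map Sigma.fst).head?, i ≠ j := by
  refine ⟨fun h => ?_, fun h => h.1.append h.2.1 h.2.2⟩
  have h2 := h.isChain
  rw [List.map_append, List.isChain_append] at h2
  exact ⟨⟨fun x hx => h.ne_one x (by simp [hx]), h2.1⟩,
    ⟨fun x hx => h.ne_one x (by simp [hx]), h2.2.1⟩, h2.2.2⟩

theorem isReducedList_singleton {x : Σ i, G i} : IsReducedList [x] ↔ x.2 ≠ 1 :=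
  ⟨fun h => h.ne_one x (by simp), fun h => ⟨by simpa using h, by simp⟩⟩

/-- The second list is reduced, represents the `n`-th power of the first one, begins and ends in the
same factors, and involves the syllables of the first one up to roots. -/
structure IsPowerList (n : ℕ) (l l' : List (Σ i, G i)) : Prop where
  isReducedList : IsReducedList l'
  head : (l'.map Sigma.fst).head? = (l.map Sigma.fst).head?
  getLast : (l'.map Sigma.fst).getLast? = (l.map Sigma.fst).getLast?
  listProd : listProd l' = listProd l ^ n
  mem_of_mem : ∀ A : ∀ i, Subgroup (G i), (∀ i, (A i).PowSaturated) →
    (∀ x ∈ l', x.2 ∈ A x.1) → ∀ x ∈ l, x.2 ∈ A x.1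

/-- As the end syllables lie in different factors, repeated copies of `l` concatenate without
reduction. -/
theorem exists_isPowerList_of_ne {l : List (Σ i, G i)} (hl : IsReducedList l) {i j : ι}
    (hi : (l.map Sigma.fst).head? = some i) (hj : (l.map Sigma.fst).getLast? = some j)
    (hij : i ≠ j) (n : ℕ) : ∃ l', IsPowerList (n + 1) l l' := by
  induction n with
  | zero => exact ⟨l, hl, rfl, rfl, by simp, fun _ _ h => h⟩
  | succ n ih =>
    obtain ⟨l', h⟩ := ih
    refine ⟨l ++ l', hl.append h.isReducedList ?_, ?_, ?_, ?_, ?_⟩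
    · rw [hj, h.head, hi]
      simpa using hij.symm
    · simp [List.head?_append, hi]
    · rw [List.map_append, List.getLast?_append, h.getLast, hj]
      rfl
    · rw [listProd_append, h.listProd, ← pow_succ']
    · exact fun A _ hA x hx => hA x (by simp [hx])

theorem getLast?_map_fst_append_singleton {ι : Type*} {M : ι → Type*} (u : List (Σ i, M i))
    (a b : Σ i, M i) : (([a] ++ (u ++ [b])).map Sigma.fst).getLast? = some b.1 := by
  rw [← List.append_assoc, List.map_append, List.getLast?_append]
  rfl

theorem exists_head?_map_fst_eq_some {ι : Type*} {M : ι → Type*} {u : List (Σ i, M i)}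
    (hu : u ≠ []) : ∃ j, (u.map Sigma.fst).head? = some j := by
  cases u with
  | nil => exact absurd rfl hu
  | cons a u => exact ⟨a.1, rfl⟩

theorem IsReducedList.ne_nil_of_cons_append {i : ι} {x y : G i} {u : List (Σ i, G i)}
    (hl : IsReducedList ([⟨i, x⟩] ++ (u ++ [⟨i, y⟩]))) : u ≠ [] := by
  rintro rfl
  simpa using (isReducedList_append_iff.1 hl).2.2

theorem IsReducedList.replace_middle {a b : Σ i, G i} {u m : List (Σ i, G i)}
    (hl : IsReducedList ([a] ++ (u ++ [b]))) (hu : u ≠ []) (hm : IsReducedList m)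
    (hh : (m.map Sigma.fst).head? = (u.map Sigma.fst).head?)
    (ht : (m.map Sigma.fst).getLast? = (u.map Sigma.fst).getLast?) :
    IsReducedList ([a] ++ (m ++ [b])) := by
  obtain ⟨ha, hub, hau⟩ := isReducedList_append_iff.1 hl
  obtain ⟨-, hb, hub⟩ := isReducedList_append_iff.1 hub
  obtain ⟨j, hj⟩ := exists_head?_map_fst_eq_some hu
  refine ha.append (hm.append hb (by rwa [ht])) ?_
  rw [List.map_append, List.head?_append, hj] at hau
  rwa [List.map_append, List.head?_append, hh, hj]

/-- At each junction `y` and `x` merge into one nontrivial syllable, so the power is `x u (yx) u ⋯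
(yx) u y`, which still contains every syllable of the original word. -/
theorem exists_isPowerList_of_mul_ne_one {i : ι} {x y : G i} {u : List (Σ i, G i)}
    (hl : IsReducedList ([⟨i, x⟩] ++ (u ++ [⟨i, y⟩]))) (hxy : y * x ≠ 1) (n : ℕ) :
    ∃ l', IsPowerList (n + 1) ([⟨i, x⟩] ++ (u ++ [⟨i, y⟩])) l' := by
  have hne := hl.ne_nil_of_cons_append
  obtain ⟨-, hu', hxu⟩ := isReducedList_append_iff.1 hl
  obtain ⟨hu, -, huy⟩ := isReducedList_append_iff.1 hu'
  obtain ⟨j, hj⟩ := exists_head?_map_fst_eq_some hne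
  have hij : i ≠ j := hxu i (by simp) j (by simp [List.head?_append, hj])
  suffices H : ∀ n : ℕ, ∃ m : List (Σ i, G i), IsReducedList m ∧
      (m.map Sigma.fst).head? = (u.map Sigma.fst).head? ∧
      (m.map Sigma.fst).getLast? = (u.map Sigma.fst).getLast? ∧
      of x * listProd m * of y = (of x * listProd u * of y) ^ (n + 1) ∧ u ⊆ m by
    obtain ⟨m, hm, hh, ht, hp, hum⟩ := H n
    refine ⟨[⟨i, x⟩] ++ (m ++ [⟨i, y⟩]), hl.replace_middle hne hm hh ht, by simp,
      by
            rw [getLast?_map_fst_append_singleton]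
            exact (getLast?_map_fst_append_singleton u _ _).symm, ?_, ?_⟩
    · simpa [mul_assoc] using hp
    · intro A _ hA z hz
      refine hA z ?_
      simp only [List.mem_append] at hz ⊢
      exact hz.imp id (Or.imp (fun h => hum h) id)
  intro n
  induction n with
  | zero => exact ⟨u, hu, rfl, rfl, by simp, fun _ h => h⟩
  | succ n ih =>
    obtain ⟨m, hm, hh, ht, hp, hum⟩ := ih
    have hs : IsReducedList ([⟨i, y * x⟩] ++ m) :=
      (isReducedList_singleton.2 hxy).append hm (by simpa [hh, hj] using hij)
    refine ⟨u ++ ([⟨i, y * x⟩] ++ m), hu.append hs (by simpa using huy), ?_, ?_, ?_, ?_⟩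
    · rw [List.map_append, List.head?_append, hj]
      rfl
    · rw [List.map_append, List.map_append, List.getLast?_append, List.getLast?_append, ht]
      cases h : (u.map Sigma.fst).getLast? with
      | none => simp_all
      | some k => rfl
    · rw [pow_succ', ← hp]
      simp [mul_assoc]
    · exact fun z hz => by simp [hz]

/-- Powers of reduced words: in a free product of torsion-free groups, a nontrivial power of a
nontrivial element begins and ends in the same factors as the element. -/
theorem exists_isPowerList [∀ i, IsMulTorsionFree (G i)] (n : ℕ) (l : List (Σ i, G i)) :
    IsReducedList l → l ≠ [] → ∃ l', IsPowerList (n + 1) l l' := by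
  induction l using List.bidirectionalRec with
  | nil => exact fun _ h => absurd rfl h
  -- The only case where torsion-freeness and the root-closure of the subgroups do any work.
  | singleton a =>
    intro ha _
    refine ⟨[⟨a.1, a.2 ^ (n + 1)⟩], isReducedList_singleton.2 ?_, rfl, rfl, by simp, ?_⟩
    · rw [Ne, pow_eq_one_iff_left n.succ_ne_zero]
      exact isReducedList_singleton.1 ha
    · intro A hA h
      simp only [List.mem_singleton, forall_eq] at h ⊢
      exact (hA _ h).resolve_left n.succ_ne_zero
  | cons_append a u b ih =>
    intro hl _
    obtain ⟨i, x⟩ := a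
    obtain ⟨k, y⟩ := b
    change IsReducedList ([⟨i, x⟩] ++ (u ++ [⟨k, y⟩])) at hl
    by_cases hik : i = k
    · subst hik
      -- If `y = x⁻¹`, the word is a conjugate of the shorter word `u`, and its powers are the
      -- conjugates of those of `u`.
      by_cases hxy : y * x = 1
      · have hne := hl.ne_nil_of_cons_append
        obtain ⟨m, hm⟩ := ih
          (isReducedList_append_iff.1 (isReducedList_append_iff.1 hl).2.1).1 hne
        refine ⟨[⟨i, x⟩] ++ (m ++ [⟨i, y⟩]),
          hl.replace_middle hne hm.isReducedList hm.head hm.getLast, by simp,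
          by
            rw [getLast?_map_fst_append_singleton]
            exact (getLast?_map_fst_append_singleton u _ _).symm, ?_, ?_⟩
        · have hyx : (of y : CoprodI G) = (of x)⁻¹ := by
            rw [eq_inv_iff_mul_eq_one, ← map_mul, hxy, map_one]
          simp [hm.listProd, hyx, ← mul_assoc, conj_pow]
        · intro A hA h z hz
          change z ∈ [_] ++ (u ++ [_]) at hz
          simp only [List.mem_append] at hz h
          rcases hz with hz | hz | hz
          · exact h z (Or.inl hz)
          · exact hm.mem_of_mem A hA (fun w hw => h w (Or.inr (Or.inl hw))) z hz
          · exact h z (Or.inr (Or.inr hz))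
      · exact exists_isPowerList_of_mul_ne_one hl hxy n
    · exact exists_isPowerList_of_ne hl (i := i) (j := k) (by simp)
        (getLast?_map_fst_append_singleton _ _ _) hik n

variable {H : ι → Type*} [∀ i, Group (H i)] (f : ∀ i, H i →* G i)

theorem lift_of_comp_listProd (l : List (Σ i, H i)) :
    lift (fun i => of.comp (f i)) (listProd l) =
      listProd (l.map (Sigma.map id fun i => f i)) := by
  induction l with
  | nil => simp
  | cons a l ih => simp [ih, Sigma.map]

variable {f}

theorem IsReducedList.map (hf : ∀ i, Function.Injective (f i)) {l : List (Σ i, H i)}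
    (hl : IsReducedList l) : IsReducedList (l.map (Sigma.map id fun i => f i)) where
  ne_one := by
    simp only [List.mem_map]
    rintro _ ⟨x, hx, rfl⟩ h
    exact hl.ne_one x hx ((map_eq_one_iff _ (hf _)).1 h)
  isChain := by
    have h := hl.isChain
    rw [List.map_map]
    exact h

theorem lift_of_comp_injective (hf : ∀ i, Function.Injective (f i)) :
    Function.Injective (lift (fun i => (of : G i →* CoprodI G).comp (f i))) := by
  rw [injective_iff_map_eq_one]
  intro t ht
  obtain ⟨l, hl, rfl⟩ := exists_isReducedList t
  rw [lift_of_comp_listProd] at ht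
  have h := (hl.map hf).eq_of_listProd_eq ⟨by simp, by simp⟩ (ht.trans listProd_nil.symm)
  rw [List.map_eq_nil_iff] at h
  rw [h, listProd_nil]

/-- The syllables of an element of a free product of subgroups lie in these subgroups. -/
theorem IsReducedList.mem_range (hf : ∀ i, Function.Injective (f i)) {l : List (Σ i, G i)}
    (hl : IsReducedList l)
    (h : listProd l ∈ (lift (fun i => (of : G i →* CoprodI G).comp (f i))).range) :
    ∀ x ∈ l, x.2 ∈ (f x.1).range := by
  obtain ⟨t, ht⟩ := h
  obtain ⟨m, hm, rfl⟩ := exists_isReducedList t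
  rw [lift_of_comp_listProd] at ht
  rw [← (hm.map hf).eq_of_listProd_eq hl ht]
  simp only [List.mem_map]
  rintro _ ⟨x, -, rfl⟩
  exact ⟨x.2, rfl⟩

/-- A nontrivial `g` is a one-syllable reduced word. This recovers each subgroup from the free
product they generate. -/
theorem of_mem_range_lift_iff (hf : ∀ i, Function.Injective (f i)) {i : ι} {g : G i} :
    of g ∈ (lift (fun i => (of : G i →* CoprodI G).comp (f i))).range ↔ g ∈ (f i).range := by
  constructor
  · intro h
    by_cases hg : g = 1
    · exact hg ▸ one_mem _
    · have hl : IsReducedList [(⟨i, g⟩ : Σ i, G i)] := isReducedList_singleton.2 hg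
      exact hl.mem_range hf (by simpa using h) ⟨i, g⟩ (by simp)
  · rintro ⟨x, rfl⟩
    exact ⟨of x, by simp⟩

/-- A free product of root-closed subgroups is root-closed in the free product. -/
theorem isRootClosedEmbedding_lift [∀ i, IsMulTorsionFree (G i)]
    (hf : ∀ i, IsRootClosedEmbedding (f i)) :
    IsRootClosedEmbedding (lift (fun i => (of : G i →* CoprodI G).comp (f i))) where
  injective := lift_of_comp_injective fun i => (hf i).injective
  rootClosed := by
    intro n t ht
    rcases n with - | n
    · exact Or.inl rfl
    refine Or.inr ?_
    obtain ⟨l, hl, rfl⟩ := exists_isReducedList t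
    by_cases hne : l = []
    · rw [hne, listProd_nil]
      exact one_mem _
    obtain ⟨l', hl'⟩ := exists_isPowerList n l hl hne
    rw [← hl'.listProd] at ht
    have h := hl'.mem_of_mem (fun i => (f i).range) (fun i => (hf i).rootClosed)
      (hl'.isReducedList.mem_range (fun i => (hf i).injective) ht)
    refine Subgroup.list_prod_mem _ ?_
    simp only [List.mem_map]
    rintro _ ⟨x, hx, rfl⟩
    exact (of_mem_range_lift_iff fun i => (hf i).injective).2 (h x hx)

end Monoid.CoprodI
open Monoid

/-! ### Transport of admissible images along root-closed embeddings. -/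

section Transport

variable {F G : Type*} [Group F] [Group G]

theorem IsAdmissibleRep.of_isRootClosedEmbedding {g : ℕ} {h : SurfaceGroup g →* F}
    (hh : IsRootClosedEmbedding h) : IsAdmissibleRep h (h (surfaceBoundary g)) :=
  ⟨rfl, hh.injective, hh.rootClosed⟩

theorem IsAdmissibleRep.isRootClosedEmbedding {g : ℕ} {h : SurfaceGroup g →* F} {x : F}
    (hh : IsAdmissibleRep h x) : IsRootClosedEmbedding h :=
  ⟨hh.injective, hh.rootClosed⟩

theorem map_mem_admissibleImages {ψ : G →* F} (hψ : IsRootClosedEmbedding ψ) {g : ℕ} {x : G}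
    {A : Subgroup G} (hA : A ∈ admissibleImages g x) : A.map ψ ∈ admissibleImages g (ψ x) := by
  obtain ⟨h, hh, rfl⟩ := hA
  obtain rfl := hh.isGenusRep
  exact ⟨ψ.comp h, .of_isRootClosedEmbedding (hψ.comp hh.isRootClosedEmbedding),
    (MonoidHom.range_comp ψ h)⟩

theorem numImages_le_of_isRootClosedEmbedding {ψ : G →* F} (hψ : IsRootClosedEmbedding ψ) (g : ℕ)
    (x : G) : numImages g x ≤ numImages g (ψ x) := by
  refine Set.encard_le_encard_of_injOn (f := Subgroup.map ψ)
    (fun A hA => map_mem_admissibleImages hψ hA) ?_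
  exact (Subgroup.map_injective hψ.injective).injOn

theorem fPrime_le_of_isRootClosedEmbedding {ψ : G →* F} (hψ : IsRootClosedEmbedding ψ) (g : ℕ) :
    fPrime G g ≤ fPrime F g :=
  iSup_le fun x => (numImages_le_of_isRootClosedEmbedding hψ g x).trans
    (le_iSup (fun y : F => numImages g y) (ψ x))

end Transport

/-! ### Boundary connected sums and free products. -/

section BoundaryConnectedSum

/-- The embedding of the first `m` handles. -/
def surfaceInl (m n : ℕ) : SurfaceGroup m →* SurfaceGroup (m + n) :=
  FreeGroup.map (Sum.map (Fin.castAdd n) (Fin.castAdd n))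

/-- The embedding of the last `n` handles. -/
def surfaceInr (m n : ℕ) : SurfaceGroup n →* SurfaceGroup (m + n) :=
  FreeGroup.map (Sum.map (Fin.natAdd m) (Fin.natAdd m))

theorem surfaceBoundary_add (m n : ℕ) : surfaceBoundary (m + n) =
    surfaceInl m n (surfaceBoundary m) * surfaceInr m n (surfaceBoundary n) := by
  simp only [surfaceBoundary, List.ofFn_add, List.prod_append, map_list_prod, List.map_ofFn]
  congr 3

/-- The genera of the two pieces of a boundary connected sum. -/
abbrev genusPair (m n : ℕ) (b : Bool) : ℕ := cond b m n

/-- The group of a boundary connected sum is the free product of the groups of the pieces. -/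
def surfaceGroupEquiv (m n : ℕ) :
    SurfaceGroup (m + n) ≃* CoprodI fun b : Bool => SurfaceGroup (genusPair m n b) :=
  MonoidHom.toMulEquiv
    (FreeGroup.lift (Sum.elim
      (Fin.addCases (fun i => CoprodI.of (i := true) (FreeGroup.of (Sum.inl i)))
        (fun i => CoprodI.of (i := false) (FreeGroup.of (Sum.inl i))))
      (Fin.addCases (fun i => CoprodI.of (i := true) (FreeGroup.of (Sum.inr i)))
        (fun i => CoprodI.of (i := false) (FreeGroup.of (Sum.inr i))))))
    (CoprodI.lift (Bool.rec (surfaceInr m n) (surfaceInl m n)))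
    (by
      ext1 i
      rcases i with i | i <;> induction i using Fin.addCases <;> simp [surfaceInl, surfaceInr])
    (by
      ext b i
      cases b <;> rcases i with i | i <;> simp [surfaceInl, surfaceInr])

theorem surfaceGroupEquiv_surfaceBoundary (m n : ℕ) :
    surfaceGroupEquiv m n (surfaceBoundary (m + n)) =
      CoprodI.of (M := fun b : Bool => SurfaceGroup (genusPair m n b)) (i := true)
          (surfaceBoundary m) *
        CoprodI.of (M := fun b : Bool => SurfaceGroup (genusPair m n b)) (i := false)
          (surfaceBoundary n) := by
  rw [← MulEquiv.eq_symm_apply, map_mul, surfaceBoundary_add]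
  simp [surfaceGroupEquiv]

variable {F : Type*} [Group F]

/-- The subgroup of `F * F` generated by a subgroup of the first factor and one of the second. -/
def coprodSubgroup (A B : Subgroup F) : Subgroup (CoprodI fun _ : Bool => F) :=
  A.map (CoprodI.of (i := true)) ⊔ B.map (CoprodI.of (i := false))

theorem range_lift_eq_coprodSubgroup {m n : ℕ}
    (h : ∀ b : Bool, SurfaceGroup (genusPair m n b) →* F) :
    (CoprodI.lift fun b => (CoprodI.of (M := fun _ : Bool => F) (i := b)).comp (h b)).range =
      coprodSubgroup (h true).range (h false).range := by
  rw [CoprodI.range_eq_iSup, iSup_bool_eq, MonoidHom.range_comp, MonoidHom.range_comp]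
  rfl

theorem coprodSubgroup_mem_admissibleImages [IsMulTorsionFree F] {m n : ℕ} {x y : F}
    {A B : Subgroup F} (hA : A ∈ admissibleImages m x) (hB : B ∈ admissibleImages n y) :
    coprodSubgroup A B ∈ admissibleImages (m + n)
        (CoprodI.of (M := fun _ : Bool => F) (i := true) x *
          CoprodI.of (M := fun _ : Bool => F) (i := false) y) ∧
      (∀ g, CoprodI.of (i := true) g ∈ coprodSubgroup A B ↔ g ∈ A) ∧
      (∀ g, CoprodI.of (i := false) g ∈ coprodSubgroup A B ↔ g ∈ B) := by
  obtain ⟨h₁, hh₁, rfl⟩ := hA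
  obtain ⟨h₂, hh₂, rfl⟩ := hB
  obtain rfl := hh₁.isGenusRep
  obtain rfl := hh₂.isGenusRep
  let h : ∀ b : Bool, SurfaceGroup (genusPair m n b) →* F := Bool.rec h₂ h₁
  have hh : ∀ b, IsRootClosedEmbedding (h b) := by
    rintro (_ | _)
    exacts [hh₂.isRootClosedEmbedding, hh₁.isRootClosedEmbedding]
  have hr := range_lift_eq_coprodSubgroup h
  change _ = coprodSubgroup h₁.range h₂.range at hr
  rw [← hr]
  refine ⟨⟨(CoprodI.lift fun b => (CoprodI.of (M := fun _ : Bool => F) (i := b)).comp (h b)).comp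
    (surfaceGroupEquiv m n).toMonoidHom, ?_, ?_⟩, fun g => ?_, fun g => ?_⟩
  · have h3 := IsAdmissibleRep.of_isRootClosedEmbedding
      ((CoprodI.isRootClosedEmbedding_lift hh).comp (.of_mulEquiv (surfaceGroupEquiv m n)))
    simpa [surfaceGroupEquiv_surfaceBoundary, h] using h3
  · have hs : (surfaceGroupEquiv m n).toMonoidHom.range = ⊤ :=
      MonoidHom.range_eq_top.2 (surfaceGroupEquiv m n).surjective
    rw [MonoidHom.range_comp, hs, ← MonoidHom.range_eq_map]
  · exact CoprodI.of_mem_range_lift_iff fun b => (hh b).injective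
  · exact CoprodI.of_mem_range_lift_iff fun b => (hh b).injective

theorem numImages_mul_le_coprodI [IsMulTorsionFree F] (m n : ℕ) (x y : F) :
    numImages m x * numImages n y ≤ fPrime (CoprodI fun _ : Bool => F) (m + n) := by
  refine le_trans ?_ (le_iSup (fun z => numImages (m + n) z)
    (CoprodI.of (M := fun _ : Bool => F) (i := true) x *
      CoprodI.of (M := fun _ : Bool => F) (i := false) y))
  rw [numImages, numImages, ← Set.encard_prod]
  refine Set.encard_le_encard_of_injOn (f := fun p => coprodSubgroup p.1 p.2)
    (fun p hp => (coprodSubgroup_mem_admissibleImages hp.1 hp.2).1) ?_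
  intro p hp q hq hpq
  obtain ⟨-, hp₁, hp₂⟩ := coprodSubgroup_mem_admissibleImages hp.1 hp.2
  obtain ⟨-, hq₁, hq₂⟩ := coprodSubgroup_mem_admissibleImages hq.1 hq.2
  simp only at hpq
  refine Prod.ext (Subgroup.ext fun g => ?_) (Subgroup.ext fun g => ?_)
  · rw [← hp₁, hpq, hq₁]
  · rw [← hp₂, hpq, hq₂]

end BoundaryConnectedSum

/-! ### Superadditivity in `F`. -/

/-- Any free group of countable rank is a root-closed subgroup of any nonabelian free group. -/
theorem exists_isRootClosedEmbedding {F L Y : Type*} [Group F] [IsFreeGroup F] [Group L]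
    [Countable Y] (hF : ∃ a b : F, a * b ≠ b * a) (B : FreeGroupBasis Y L) :
    ∃ f : L →* F, IsRootClosedEmbedding f := by
  have := nontrivial_of_freeGroupBasis (IsFreeGroup.basis F) hF
  obtain ⟨f, hf⟩ := exists_isRootClosedEmbedding_freeGroup (X := IsFreeGroup.Generators F) Y
  exact ⟨_, (IsRootClosedEmbedding.of_mulEquiv (IsFreeGroup.mulEquiv F)).comp
    (hf.comp (.of_mulEquiv B.repr))⟩

theorem fPrime_mul_le (F : Type*) [Group F] [IsFreeGroup F] [Group.FG F]
    (hF : ∃ a b : F, a * b ≠ b * a) (m n : ℕ) :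
    fPrime F m * fPrime F n ≤ fPrime F (m + n) := by
  have : IsMulTorsionFree F :=
    (IsFreeGroup.toFreeGroup F).injective.isMulTorsionFree (IsFreeGroup.toFreeGroup F).toMonoidHom
  have := countable_of_group_fg F
  have : Countable (IsFreeGroup.Generators F) := (IsFreeGroup.basis F).injective.countable
  obtain ⟨f, hf⟩ := exists_isRootClosedEmbedding hF
    (CoprodI.FreeGroupBasis.coprodI fun _ : Bool => IsFreeGroup.basis F)
  -- Multiplication in `ℕ∞` commutes with suprema, so it suffices to bound each pair `x`, `y`,
  -- whether or not the suprema are attained.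
  rw [fPrime, fPrime, ENat.iSup_mul]
  refine iSup_le fun x => ?_
  rw [ENat.mul_iSup]
  exact iSup_le fun y => (numImages_mul_le_coprodI m n x y).trans
    (fPrime_le_of_isRootClosedEmbedding hf (m + n))

/-! ### Two once-punctured tori with the same boundary. -/

section TwoTori

/-- The homomorphism from `H₁` sending `a₁` to `x` and `b₁` to `y`. -/
def torusHom {G : Type*} [Group G] (x y : G) : SurfaceGroup 1 →* G :=
  FreeGroup.lift (Sum.elim (fun _ => x) fun _ => y)

theorem torusHom_surfaceBoundary {G : Type*} [Group G] (x y : G) :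
    torusHom x y (surfaceBoundary 1) = ⁅x, y⁆ := by
  simp [torusHom, surfaceBoundary, map_commutatorElement]

theorem comp_torusHom {G K : Type*} [Group G] [Group K] (f : G →* K) (x y : G) :
    f.comp (torusHom x y) = torusHom (f x) (f y) := by
  ext1 i
  rcases i with i | i <;> simp [torusHom]

theorem torusHom_of : torusHom (FreeGroup.of (Sum.inl 0)) (FreeGroup.of (Sum.inr 0)) =
    MonoidHom.id (SurfaceGroup 1) := by
  ext1 i
  rcases i with i | i <;> simp [torusHom, Subsingleton.elim i 0]

local notation "𝐚" => (FreeGroup.of true : FreeGroup Bool)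
local notation "𝐛" => (FreeGroup.of false : FreeGroup Bool)
local notation "𝐲" => (FreeGroup.of : ℤ → FreeGroup ℤ)

/-- Both generators have height zero when `𝐚` and `𝐛` have height 1. Killing all of the basis of
`FreeGroup ℤ` except `𝐲 0` and `𝐲 1` retracts onto `H₁`. -/
theorem isRootClosedEmbedding_torusHom_first :
    IsRootClosedEmbedding (torusHom (𝐛⁻¹ * 𝐚) (𝐚⁻¹ * 𝐛⁻¹ * 𝐚 * 𝐚 * 𝐚 * 𝐛⁻¹)) := by
  refine .of_semidirectProduct _
    (FreeGroup.lift fun c => cond c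
      (SemidirectProduct.inr (Multiplicative.ofAdd 1) * SemidirectProduct.inl (𝐲 0))
      (SemidirectProduct.inr (Multiplicative.ofAdd 1)) :
      FreeGroup Bool →* FreeGroup ℤ ⋊[freeGroupShift] Multiplicative ℤ)
    (torusHom (𝐲 0) ((𝐲 0)⁻¹ * 𝐲 (-1) * 𝐲 0 * 𝐲 1))
    (FreeGroup.lift fun i => if i = 0 then FreeGroup.of (Sum.inl 0) else
      if i = 1 then FreeGroup.of (Sum.inr 0) else 1) ?_ ?_
  · rw [comp_torusHom, comp_torusHom]
    rfl
  · rw [comp_torusHom, ← torusHom_of]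
    simp

/-- Here the heights are 1 for `𝐚` and 2 for `𝐛`. The retraction keeps `𝐲 (-2)` and `𝐲 (-3)`, with
values chosen to invert the images of the two generators. -/
theorem isRootClosedEmbedding_torusHom_second :
    IsRootClosedEmbedding (torusHom (𝐛⁻¹ * 𝐛⁻¹ * 𝐚 * 𝐛 * 𝐚) (𝐚⁻¹ * 𝐛⁻¹ * 𝐚 * 𝐚 * 𝐚)) := by
  refine .of_semidirectProduct _
    (FreeGroup.lift fun c => cond c
      (SemidirectProduct.inr (Multiplicative.ofAdd 1))
      (SemidirectProduct.inl (𝐲 0) * SemidirectProduct.inr (Multiplicative.ofAdd 2)) :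
      FreeGroup Bool →* FreeGroup ℤ ⋊[freeGroupShift] Multiplicative ℤ)
    (torusHom ((𝐲 (-2))⁻¹ * (𝐲 (-4))⁻¹ * 𝐲 (-3)) (𝐲 (-3))⁻¹)
    (FreeGroup.lift fun i => if i = -2 then (FreeGroup.of (Sum.inl 0) * FreeGroup.of (Sum.inr 0))⁻¹
      else if i = -3 then (FreeGroup.of (Sum.inr 0))⁻¹ else 1) ?_ ?_
  · rw [comp_torusHom, comp_torusHom]
    rfl
  · rw [comp_torusHom, ← torusHom_of]
    simp

/-- Both sides reduce to `b⁻² a³ b⁻¹ a⁻¹ b² a⁻³ b a`. -/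
theorem commutator_first_eq_commutator_second :
    ⁅𝐛⁻¹ * 𝐚, 𝐚⁻¹ * 𝐛⁻¹ * 𝐚 * 𝐚 * 𝐚 * 𝐛⁻¹⁆ =
      ⁅𝐛⁻¹ * 𝐛⁻¹ * 𝐚 * 𝐛 * 𝐚, 𝐚⁻¹ * 𝐛⁻¹ * 𝐚 * 𝐚 * 𝐚⁆ := by
  simp [commutatorElement_def, mul_assoc]

theorem range_first_ne_range_second :
    (torusHom (𝐛⁻¹ * 𝐚) (𝐚⁻¹ * 𝐛⁻¹ * 𝐚 * 𝐚 * 𝐚 * 𝐛⁻¹)).range ≠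
      (torusHom (𝐛⁻¹ * 𝐛⁻¹ * 𝐚 * 𝐛 * 𝐚) (𝐚⁻¹ * 𝐛⁻¹ * 𝐚 * 𝐚 * 𝐚)).range := by
  intro h
  -- The total exponent vanishes on the first image but is 1 on the first generator of the second.
  let χ : FreeGroup Bool →* Multiplicative ℤ := FreeGroup.lift fun _ => Multiplicative.ofAdd 1
  have h1 : 𝐛⁻¹ * 𝐛⁻¹ * 𝐚 * 𝐛 * 𝐚 ∈
      (torusHom (𝐛⁻¹ * 𝐚) (𝐚⁻¹ * 𝐛⁻¹ * 𝐚 * 𝐚 * 𝐚 * 𝐛⁻¹)).range :=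
    h ▸ ⟨FreeGroup.of (Sum.inl 0), by simp [torusHom]⟩
  obtain ⟨t, ht⟩ := h1
  have h2 : χ.comp (torusHom (𝐛⁻¹ * 𝐚) (𝐚⁻¹ * 𝐛⁻¹ * 𝐚 * 𝐚 * 𝐚 * 𝐛⁻¹)) = 1 := by
    ext1 i
    rcases i with i | i <;> simp [χ, torusHom]
  have h3 := DFunLike.congr_fun h2 t
  rw [MonoidHom.comp_apply, ht] at h3
  revert h3
  simp [χ]

theorem two_le_fPrime_freeGroup_bool : 2 ≤ fPrime (FreeGroup Bool) 1 := by
  refine le_trans ?_ (le_iSup (fun x : FreeGroup Bool => numImages 1 x)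
    ⁅𝐛⁻¹ * 𝐚, 𝐚⁻¹ * 𝐛⁻¹ * 𝐚 * 𝐚 * 𝐚 * 𝐛⁻¹⁆)
  rw [numImages, ← Set.encard_pair range_first_ne_range_second]
  refine Set.encard_le_encard (Set.pair_subset ?_ ?_)
  · have h := isRootClosedEmbedding_torusHom_first
    exact ⟨_, ⟨torusHom_surfaceBoundary _ _, h.injective, h.rootClosed⟩, rfl⟩
  · have h := isRootClosedEmbedding_torusHom_second
    exact ⟨_, ⟨(torusHom_surfaceBoundary _ _).trans commutator_first_eq_commutator_second.symm,
      h.injective, h.rootClosed⟩, rfl⟩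

end TwoTori

theorem mainTheorem1 (F : Type*) [Group F] [IsFreeGroup F] [Group.FG F]
    (hF : ∃ a b : F, a * b ≠ b * a) :
    2 ≤ fPrime F 1 ∧ ∀ m n : ℕ, fPrime F m * fPrime F n ≤ fPrime F (m + n) := by
  refine ⟨?_, fPrime_mul_le F hF⟩
  obtain ⟨f, hf⟩ := exists_isRootClosedEmbedding hF (FreeGroupBasis.ofFreeGroup Bool)
  exact two_le_fPrime_freeGroup_bool.trans (fPrime_le_of_isRootClosedEmbedding hf 1)
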